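/- For every time $T\ge 0$ let $\Omega_T$ be a measurable space of trajectories, $\mathbb P_T$ a probability measure on it, and $R:\Omega_T\to\Omega_T$ a bijection, measurable with measurable inverse, such that the measure $\mathbb P_T\circ R$, given by $(\mathbb P_T\circ R)(C)=\mathbb P_T(R(C))$, is equivalent to $\mathbb P_T$. Define the entropic functional $\varSigma_T^{\mathbb P}:\Omega_T\to\mathbb R$ by $$\exp\big(-\varSigma_T^{\mathbb P}\big)=\frac{d(\mathbb P_T\circ R)}{d\mathbb P_T}.$$ Let $A_T:\Omega_T\to\mathbb R^n$ be measurable, and suppose that there are a vector $w\in\mathbb R^n$ and an invertible real $n\times n$ matrix $\mathcal R$, both independent of $T$, and functionals $B_T:\Omega_T\to\mathbb R$ such that for every $T$, almost surely, $$\varSigma_T^{\mathbb P}=\langle w,A_T\rangle+B_T,\qquad A_T\circ R=\mathcal R A_T,$$ and $\lim_{T\to\infty}\frac1T\,\operatorname{ess\,sup}|B_T|=0$. Suppose that for every $k\in\mathbb R^n$ the limit $$\Lambda(k)=\lim_{T\to\infty}\frac1T\ln\mathbb E_{\mathbb P_T}\big[e^{\langle k,A_T\rangle}\big]$$ exists in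 $[-\infty,+\infty]$, and that one of the following holds. (a) $\Lambda$ is finite and differentiable on all of $\mathbb R^n$. (b) $\Lambda$ is essentially smooth: with $S=\{k:\Lambda(k)\text{ is finite}\}$ and $S^\circ$ its interior, $0\in S^\circ$, $\Lambda$ is differentiable on $S^\circ$, and $|\nabla\Lambda(k_m)|\to\infty$ for every sequence $(k_m)$ in $S^\circ$ that converges to a boundary point of $S^\circ$. Then, with $\mathcal R^\dagger$ the transpose of $\mathcal R$, for every $k\in\mathbb R^n$, $$\Lambda\big((\mathcal R^\dagger)^{-1}k\big)=\Lambda(k-w).$$ Moreover, the laws of $A_T/T$ under $\mathbb P_T$ satisfy a large deviation principle with speed $T$, as $T\to\infty$, with the lower semicontinuous rate function $I:\mathbb R^n\to[0,\infty]$ given by $I(a)=\sup_{k\in\mathbb R^n}\big(\langle k,a\rangle-\Lambda(k)\big)$, that is, for every Borel set $C\subseteq\mathbb R^n$, $$-\inf_{a\in C^\circ}I(a)\le\liminf_{T\to\infty}\frac1T\ln\mathbb P_T\Big(\frac{A_T}{T}\in C\Big)\le\limsup_{T\to\infty}\frac1T\ln\mathbb P_T\Big(\frac{A_T}{T}\in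 C\Big)\le-\inf_{a\in\overline C}I(a),$$ and for every $a\in\mathbb R^n$, $$I(\mathcal R a)=\langle w,a\rangle+I(a).$$ -/

import Mathlib

open MeasureTheory Filter Topology
open scoped NNReal ENNReal

noncomputable section

namespace FluctuationRelation

/-- The scalar entropic functional of two measures `P`, `Q` on a path space and of a bimeasurable
bijection `R` of that space: `exp (-Σ) = d(Q ∘ R) / dP`. Here `Q ∘ R` is the measure
`B ↦ Q (R '' B)`, that is, the image of `Q` under the inverse of `R`. -/
def entropicFunctional {Ω : Type*} [MeasurableSpace Ω] (P Q : Measure Ω) (R : Ω ≃ᵐ Ω) (x : Ω) : ℝ :=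
  -Real.log ((Q.map R.symm).rnDeriv P x).toReal

/-- The cumulant generating function `k ↦ log E_P[exp ⟨k, A⟩]` of a vector-valued observable,
with values in the extended reals (it is `⊤` where the exponential moment is infinite). -/
def cumulantGenFun {Ω : Type*} [MeasurableSpace Ω] {n : ℕ} (P : Measure Ω)
    (A : Ω → EuclideanSpace ℝ (Fin n)) (k : EuclideanSpace ℝ (Fin n)) : EReal :=
  ENNReal.log (∫⁻ x, ENNReal.ofReal (Real.exp (inner ℝ k (A x))) ∂P)

/-- `L` is the scaled cumulant generating function of the family `(A T)` under `(P T)`: for every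
`k` the limit of `(1 / T) * log E[exp ⟨k, A T⟩]` as `T → ∞` exists in the extended reals and is
`L k`. -/
def IsScaledCumulantGenFun {Ω : ℝ≥0 → Type*} [∀ T, MeasurableSpace (Ω T)] {n : ℕ}
    (P : ∀ T, Measure (Ω T)) (A : ∀ T, Ω T → EuclideanSpace ℝ (Fin n))
    (L : EuclideanSpace ℝ (Fin n) → EReal) : Prop :=
  ∀ k, Tendsto (fun T : ℝ≥0 => cumulantGenFun (P T) (A T) k / ((T : ℝ) : EReal)) atTop (𝓝 (L k))

/-- The set where an extended-real-valued function is finite. -/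
def finiteSet {E : Type*} (L : E → EReal) : Set E :=
  {k | L k ≠ ⊥ ∧ L k ≠ ⊤}

/-- `L` is finite everywhere and differentiable. -/
structure IsFiniteDifferentiable {n : ℕ} (L : EuclideanSpace ℝ (Fin n) → EReal) : Prop where
  finite : ∀ k, k ∈ finiteSet L
  differentiable : Differentiable ℝ (fun k => (L k).toReal)

/-- Essential smoothness: the origin is interior to the set `S` where `L` is finite, `L` is
differentiable on the interior of `S`, and `L` is steep at the boundary of that interior. -/
structure IsEssentiallySmooth {n : ℕ} (L : EuclideanSpace ℝ (Fin n) → EReal) : Prop where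
  zero_mem : (0 : EuclideanSpace ℝ (Fin n)) ∈ interior (finiteSet L)
  differentiableAt : ∀ k ∈ interior (finiteSet L), DifferentiableAt ℝ (fun x => (L x).toReal) k
  steep : ∀ (u : ℕ → EuclideanSpace ℝ (Fin n)) (x : EuclideanSpace ℝ (Fin n)),
    (∀ m, u m ∈ interior (finiteSet L)) → x ∈ frontier (interior (finiteSet L)) →
    Tendsto u atTop (𝓝 x) →
    Tendsto (fun m => ‖gradient (fun y => (L y).toReal) (u m)‖) atTop atTop

/-- The family `(μ T)` of measures on `E` satisfies the large deviation principle with speed `T`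
and rate function `I : E → [0, ∞]`, as `T → ∞`. -/
structure IsLargeDeviationPrinciple {E : Type*} [TopologicalSpace E] [MeasurableSpace E]
    (μ : ℝ≥0 → Measure E) (I : E → EReal) : Prop where
  nonneg : ∀ x, 0 ≤ I x
  lowerSemicontinuous : LowerSemicontinuous I
  lower_bound : ∀ B : Set E, MeasurableSet B →
    -(⨅ x ∈ interior B, I x) ≤
      liminf (fun T : ℝ≥0 => ENNReal.log (μ T B) / ((T : ℝ) : EReal)) atTop
  upper_bound : ∀ B : Set E, MeasurableSet B →
    limsup (fun T : ℝ≥0 => ENNReal.log (μ T B) / ((T : ℝ) : EReal)) atTop ≤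
      -(⨅ x ∈ closure B, I x)

/-- The Legendre–Fenchel transform `a ↦ sup_k (⟨k, a⟩ - L k)`. -/
def legendreTransform {n : ℕ} (L : EuclideanSpace ℝ (Fin n) → EReal)
    (a : EuclideanSpace ℝ (Fin n)) : EReal :=
  ⨆ k : EuclideanSpace ℝ (Fin n), ((inner ℝ k a : ℝ) : EReal) - L k

end FluctuationRelation

end

/-!
The symmetry of `L` is a change of measure. Writing `E[exp ⟨k', A⟩]` as an integral of
`exp ⟨k', A ∘ R⟩` against `P ∘ R`, whose density with respect to `P` is `exp (-⟨w, A⟩ - B)`, and using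
`A ∘ R = M A`, one gets the exponential moment of `A` at `Mᵀ k' - w` up to a factor `exp (± ess sup |B|)`,
which is invisible on the exponential scale (`expMoment_eq_of_covariant`, `expMoment_compare`). The
symmetry of the rate function follows by substituting in the Legendre transform
(`legendreTransform_covariant`).

The large deviation principle is the Gärtner–Ellis theorem. Both bounds rest on one estimate,
`expGrowthLE_of_cover`: Chernoff's bound, under an exponential tilt, for a set covered by finitely
many half-spaces.

* Upper bound: a closed set on which the Legendre transform exceeds `α` has such a cover with rate
  `α`, by compactness inside a large ball and because `L` is finite near `0` outside of it.
* Lower bound: if `L` is differentiable at `k` with gradient `y`, then the complement of any ball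
  about `y` has such a cover under the `k`-tilted laws, with an exponential gain. So the tilted laws
  concentrate at `y`, and undoing the tilt gives the lower bound `L k - ⟨k, y⟩` near `y`
  (`le_liminf_of_hasGradientAt`).
* Such gradients suffice: given `a` with finite Legendre transform, the minimiser `k` of
  `L - ⟨·, a⟩ + ε ‖·‖² / 2` has gradient `y = a - ε k`, which tends to `a` as `ε → 0`, and
  `⟨k, y⟩ - L k` is at most the Legendre transform at `a` (`exists_hasGradientAt_near`). Steepness is
  what keeps the minimiser away from the boundary of the effective domain (`exists_isMinOn_of_steep`).
  This replaces the usual passage through the relative interior of the domain of the rate function.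
-/

namespace FluctuationRelation

/-! ### Exponential growth rates -/

theorem log_div_le_iff {z : ℝ≥0∞} {c : ℝ} {T : ℝ≥0} (hT : 0 < T) :
    ENNReal.log z / ((T : ℝ) : EReal) ≤ c ↔ z ≤ ENNReal.ofReal (Real.exp (c * T)) := by
  have hT' : (0 : EReal) < ((T : ℝ) : EReal) := by exact_mod_cast hT
  rw [EReal.div_le_iff_le_mul hT' (EReal.coe_ne_top _), ← EReal.coe_mul, ← ENNReal.log_le_log_iff,
    ENNReal.log_ofReal_of_pos (Real.exp_pos _), Real.log_exp, mul_comm]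

theorem le_log_div_iff {z : ℝ≥0∞} {c : ℝ} {T : ℝ≥0} (hT : 0 < T) :
    c ≤ ENNReal.log z / ((T : ℝ) : EReal) ↔ ENNReal.ofReal (Real.exp (c * T)) ≤ z := by
  have hT' : (0 : EReal) < ((T : ℝ) : EReal) := by exact_mod_cast hT
  rw [EReal.le_div_iff_mul_le hT' (EReal.coe_ne_top _), ← EReal.coe_mul, ← ENNReal.log_le_log_iff,
    ENNReal.log_ofReal_of_pos (Real.exp_pos _), Real.log_exp]

/-- The family `z` grows at exponential rate at most `c`: for every `β > c`, eventually
`z T ≤ exp (β T)`. -/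
def ExpGrowthLE (z : ℝ≥0 → ℝ≥0∞) (c : ℝ) : Prop :=
  ∀ β : ℝ, c < β → ∀ᶠ T : ℝ≥0 in atTop, z T ≤ ENNReal.ofReal (Real.exp (β * T))

theorem ExpGrowthLE.mono {y z : ℝ≥0 → ℝ≥0∞} {c d : ℝ} (hz : ExpGrowthLE z c)
    (hyz : ∀ᶠ T in atTop, y T ≤ z T) (hcd : c ≤ d) : ExpGrowthLE y d := fun β hβ => by
  filter_upwards [hyz, hz β (hcd.trans_lt hβ)] with T hT hT' using hT.trans hT'

theorem ExpGrowthLE.exp_mul {z : ℝ≥0 → ℝ≥0∞} {c : ℝ} (hz : ExpGrowthLE z c) (d : ℝ) :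
    ExpGrowthLE (fun T => ENNReal.ofReal (Real.exp (d * T)) * z T) (d + c) := fun β hβ => by
  filter_upwards [hz (β - d) (by linarith)] with T hT
  calc ENNReal.ofReal (Real.exp (d * T)) * z T
      ≤ ENNReal.ofReal (Real.exp (d * T)) * ENNReal.ofReal (Real.exp ((β - d) * T)) := by gcongr
    _ = ENNReal.ofReal (Real.exp (β * T)) := by
      rw [← ENNReal.ofReal_mul (Real.exp_pos _).le, ← Real.exp_add]; ring_nf

theorem ExpGrowthLE.limsup_le {z : ℝ≥0 → ℝ≥0∞} {c : ℝ} (hz : ExpGrowthLE z c) :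
    limsup (fun T : ℝ≥0 => ENNReal.log (z T) / ((T : ℝ) : EReal)) atTop ≤ c := by
  refine EReal.le_of_forall_lt_iff_le.1 fun β hβ => ?_
  refine limsup_le_of_le (by isBoundedDefault) ?_
  filter_upwards [hz β (by exact_mod_cast hβ), eventually_gt_atTop 0] with T hT hpos
  exact (log_div_le_iff hpos).2 hT

theorem le_liminf_log_div {z : ℝ≥0 → ℝ≥0∞} {c : ℝ}
    (hz : ∀ β < c, ∀ᶠ T : ℝ≥0 in atTop, ENNReal.ofReal (Real.exp (β * T)) ≤ z T) :
    (c : EReal) ≤ liminf (fun T : ℝ≥0 => ENNReal.log (z T) / ((T : ℝ) : EReal)) atTop := by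
  refine EReal.ge_of_forall_gt_iff_ge.1 fun β hβ => ?_
  refine le_liminf_of_le (by isBoundedDefault) ?_
  filter_upwards [hz β (by exact_mod_cast hβ), eventually_gt_atTop 0] with T hT hpos
  exact (le_log_div_iff hpos).2 hT

theorem eventually_le_exp_mul (C : ℝ) {δ : ℝ} (hδ : 0 < δ) :
    ∀ᶠ T : ℝ≥0 in atTop, C ≤ Real.exp (δ * T) := by
  have h : Tendsto (fun T : ℝ≥0 => Real.exp (δ * T)) atTop atTop :=
    Real.tendsto_exp_atTop.comp ((NNReal.tendsto_coe_atTop.2 tendsto_id).const_mul_atTop hδ)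
  exact h.eventually_ge_atTop C

theorem ExpGrowthLE.sum {ι : Type*} (s : Finset ι) {z : ι → ℝ≥0 → ℝ≥0∞} {c : ℝ}
    (hz : ∀ i ∈ s, ExpGrowthLE (z i) c) : ExpGrowthLE (fun T => ∑ i ∈ s, z i T) c := by
  intro β hβ
  obtain ⟨γ, hcγ, hγβ⟩ := exists_between hβ
  have h := (Finset.eventually_all s).2 fun i hi => hz i hi γ hcγ
  filter_upwards [h, eventually_le_exp_mul (s.card : ℝ) (sub_pos.2 hγβ)] with T hT hcard
  calc ∑ i ∈ s, z i T ≤ ∑ _i ∈ s, ENNReal.ofReal (Real.exp (γ * T)) := Finset.sum_le_sum hT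
    _ = ENNReal.ofReal (s.card * Real.exp (γ * T)) := by
      rw [Finset.sum_const, nsmul_eq_mul, ENNReal.ofReal_mul (by positivity),
        ENNReal.ofReal_natCast]
    _ ≤ ENNReal.ofReal (Real.exp (β * T)) := by
      refine ENNReal.ofReal_le_ofReal ?_
      calc s.card * Real.exp (γ * T) ≤ Real.exp ((β - γ) * T) * Real.exp (γ * T) := by gcongr
        _ = Real.exp (β * T) := by rw [← Real.exp_add]; ring_nf

/-! ### Exponential moments -/

section Moments

variable {n : ℕ}

/-- The exponential moment `k ↦ E_P[exp ⟨k, A⟩]`, whose logarithm is `cumulantGenFun P A`. -/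
noncomputable def expMoment {Ω : Type*} [MeasurableSpace Ω] (P : Measure Ω)
    (A : Ω → EuclideanSpace ℝ (Fin n)) (k : EuclideanSpace ℝ (Fin n)) : ℝ≥0∞ :=
  ∫⁻ x, ENNReal.ofReal (Real.exp (inner ℝ k (A x))) ∂P

theorem measurable_expInner {Ω : Type*} [MeasurableSpace Ω] {A : Ω → EuclideanSpace ℝ (Fin n)}
    (hA : Measurable A) (k : EuclideanSpace ℝ (Fin n)) :
    Measurable fun x => ENNReal.ofReal (Real.exp (inner ℝ k (A x))) := by
  fun_prop

theorem expMoment_combo_le {Ω : Type*} [MeasurableSpace Ω] (P : Measure Ω)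
    {A : Ω → EuclideanSpace ℝ (Fin n)} (hA : Measurable A) (x y : EuclideanSpace ℝ (Fin n))
    {a b : ℝ} (ha : 0 ≤ a) (hb : 0 ≤ b) (hab : a + b = 1) :
    expMoment P A (a • x + b • y) ≤ expMoment P A x ^ a * expMoment P A y ^ b := by
  refine le_trans (le_of_eq ?_) (ENNReal.lintegral_mul_norm_pow_le
    (measurable_expInner hA x).aemeasurable (measurable_expInner hA y).aemeasurable ha hb hab)
  refine lintegral_congr fun ω => ?_
  rw [ENNReal.ofReal_rpow_of_pos (Real.exp_pos _), ENNReal.ofReal_rpow_of_pos (Real.exp_pos _),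
    ← ENNReal.ofReal_mul (by positivity), ← Real.exp_mul, ← Real.exp_mul, ← Real.exp_add,
    inner_add_left, inner_smul_left, inner_smul_left]
  simp [mul_comm]

/-- Chernoff's bound under an exponential tilt. -/
theorem setLIntegral_exp_halfspace_le {Ω : Type*} [MeasurableSpace Ω] (P : Measure Ω)
    {A : Ω → EuclideanSpace ℝ (Fin n)} (hA : Measurable A) (k h : EuclideanSpace ℝ (Fin n))
    (c : ℝ) :
    ∫⁻ x in {x | c ≤ inner ℝ h (A x)}, ENNReal.ofReal (Real.exp (inner ℝ k (A x))) ∂P ≤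
      ENNReal.ofReal (Real.exp (-c)) * expMoment P A (k + h) := by
  have hm : MeasurableSet {x | c ≤ inner ℝ h (A x)} :=
    measurableSet_le measurable_const (by fun_prop)
  rw [expMoment, ← lintegral_const_mul _ (measurable_expInner hA _)]
  refine le_trans (setLIntegral_mono' hm fun x hx => ?_) (setLIntegral_le_lintegral _ _)
  rw [← ENNReal.ofReal_mul (Real.exp_pos _).le, ← Real.exp_add]
  refine ENNReal.ofReal_le_ofReal (Real.exp_le_exp.2 ?_)
  rw [inner_add_left]
  have : c ≤ inner ℝ h (A x) := hx
  linarith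

/-- For every `r`, the same finitely many half-spaces `{v | r ≤ ⟨h, v⟩}` cover the complement of
the ball of radius `r` about the origin. -/
theorem exists_finset_norm_le_inner (n : ℕ) : ∃ H : Finset (EuclideanSpace ℝ (Fin n)),
    ∀ v, ∃ h ∈ H, ‖v‖ ≤ inner ℝ h v := by
  classical
  obtain ⟨t, -, ht, hcov⟩ := (isCompact_closedBall (0 : EuclideanSpace ℝ (Fin n))
    1).finite_cover_balls (show (0 : ℝ) < 1 / 2 by norm_num)
  refine ⟨ht.toFinset.image fun u => (2 : ℝ) • u, fun v => ?_⟩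
  have hv : ‖v‖⁻¹ • v ∈ Metric.closedBall (0 : EuclideanSpace ℝ (Fin n)) 1 := by
    rw [mem_closedBall_zero_iff, norm_smul, norm_inv, norm_norm]
    exact inv_mul_le_one
  obtain ⟨u, hu, huv⟩ := Set.mem_iUnion₂.1 (hcov hv)
  refine ⟨(2 : ℝ) • u, Finset.mem_image.2 ⟨u, ht.mem_toFinset.2 hu, rfl⟩, ?_⟩
  rw [mem_ball_iff_norm] at huv
  have h1 : inner ℝ (‖v‖⁻¹ • v - u) v ≤ 1 / 2 * ‖v‖ :=
    (real_inner_le_norm _ _).trans (by gcongr)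
  have h2 : inner ℝ (‖v‖⁻¹ • v) v = ‖v‖ := by
    rw [real_inner_smul_left, real_inner_self_eq_norm_sq]
    rcases eq_or_ne ‖v‖ 0 with h | h
    · simp [h]
    · field_simp
  rw [inner_sub_left, h2] at h1
  rw [real_inner_smul_left]
  linarith

end Moments

/-! ### The scaled cumulant generating function -/

section Convexity

variable {n : ℕ} {L : EuclideanSpace ℝ (Fin n) → EReal}

theorem coe_toReal_of_mem_finiteSet {E : Type*} {L : E → EReal} {k : E} (hk : k ∈ finiteSet L) :
    ((L k).toReal : EReal) = L k :=
  EReal.coe_toReal hk.2 hk.1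

variable {Ω : ℝ≥0 → Type*} [∀ T, MeasurableSpace (Ω T)]
  {P : ∀ T, Measure (Ω T)} {A : ∀ T, Ω T → EuclideanSpace ℝ (Fin n)}

theorem IsScaledCumulantGenFun.eventually_le (hL : IsScaledCumulantGenFun P A L)
    {k : EuclideanSpace ℝ (Fin n)} {c : ℝ} (h : L k < c) :
    ∀ᶠ T : ℝ≥0 in atTop, expMoment (P T) (A T) k ≤ ENNReal.ofReal (Real.exp (c * T)) := by
  filter_upwards [(hL k).eventually_lt_const h, eventually_gt_atTop 0] with T hT hpos
  exact (log_div_le_iff hpos).1 hT.le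

theorem IsScaledCumulantGenFun.eventually_ge (hL : IsScaledCumulantGenFun P A L)
    {k : EuclideanSpace ℝ (Fin n)} {c : ℝ} (h : c < L k) :
    ∀ᶠ T : ℝ≥0 in atTop, ENNReal.ofReal (Real.exp (c * T)) ≤ expMoment (P T) (A T) k := by
  filter_upwards [(hL k).eventually_const_lt h, eventually_gt_atTop 0] with T hT hpos
  exact (le_log_div_iff hpos).1 hT.le

theorem IsScaledCumulantGenFun.le_of_eventually_le (hL : IsScaledCumulantGenFun P A L)
    {k : EuclideanSpace ℝ (Fin n)} {c : ℝ}
    (h : ∀ᶠ T : ℝ≥0 in atTop, expMoment (P T) (A T) k ≤ ENNReal.ofReal (Real.exp (c * T))) :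
    L k ≤ c := by
  refine le_of_tendsto (hL k) ?_
  filter_upwards [h, eventually_gt_atTop 0] with T hT hpos
  exact (log_div_le_iff hpos).2 hT

theorem IsScaledCumulantGenFun.expGrowthLE (hL : IsScaledCumulantGenFun P A L)
    {k : EuclideanSpace ℝ (Fin n)} (hk : k ∈ finiteSet L) :
    ExpGrowthLE (fun T => expMoment (P T) (A T) k) (L k).toReal := fun β hβ =>
  hL.eventually_le (by rw [← coe_toReal_of_mem_finiteSet hk]; exact_mod_cast hβ)

theorem IsScaledCumulantGenFun.apply_zero [∀ T, IsProbabilityMeasure (P T)]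
    (hL : IsScaledCumulantGenFun P A L) : L 0 = 0 := by
  refine tendsto_nhds_unique (hL 0) (tendsto_const_nhds.congr fun T => ?_)
  simp [cumulantGenFun]

/-- Convexity of a scaled cumulant generating function, in a form that makes sense for arbitrary
extended real values: strict real upper bounds at two points combine. -/
theorem IsScaledCumulantGenFun.combo_le (hL : IsScaledCumulantGenFun P A L)
    (hA : ∀ T, Measurable (A T)) {x y : EuclideanSpace ℝ (Fin n)} {α β a b : ℝ}
    (hx : L x < α) (hy : L y < β) (ha : 0 ≤ a) (hb : 0 ≤ b) (hab : a + b = 1) :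
    L (a • x + b • y) ≤ ((a * α + b * β : ℝ) : EReal) := by
  refine hL.le_of_eventually_le ?_
  filter_upwards [hL.eventually_le hx, hL.eventually_le hy] with T hxT hyT
  refine (expMoment_combo_le (P T) (hA T) x y ha hb hab).trans ?_
  calc expMoment (P T) (A T) x ^ a * expMoment (P T) (A T) y ^ b
      ≤ ENNReal.ofReal (Real.exp (α * T)) ^ a * ENNReal.ofReal (Real.exp (β * T)) ^ b := by gcongr
    _ = ENNReal.ofReal (Real.exp ((a * α + b * β) * T)) := by
      rw [ENNReal.ofReal_rpow_of_pos (Real.exp_pos _), ENNReal.ofReal_rpow_of_pos (Real.exp_pos _),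
        ← ENNReal.ofReal_mul (by positivity), ← Real.exp_mul, ← Real.exp_mul, ← Real.exp_add]
      ring_nf

theorem lt_coe_toReal_add {k : EuclideanSpace ℝ (Fin n)} (hk : k ∈ finiteSet L) {ε : ℝ}
    (hε : 0 < ε) : L k < (((L k).toReal + ε : ℝ) : EReal) := by
  conv_lhs => rw [← coe_toReal_of_mem_finiteSet hk]
  exact_mod_cast lt_add_of_pos_right _ hε

theorem IsScaledCumulantGenFun.ne_bot [∀ T, IsProbabilityMeasure (P T)]
    (hL : IsScaledCumulantGenFun P A L) (hA : ∀ T, Measurable (A T))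
    (h0 : (0 : EuclideanSpace ℝ (Fin n)) ∈ interior (finiteSet L))
    (k : EuclideanSpace ℝ (Fin n)) : L k ≠ ⊥ := by
  intro hk
  -- The origin lies strictly between `k` and a point `-s • k` at which `L` is finite.
  obtain ⟨s, hs, hs0⟩ : ∃ s : ℝ, (-s) • k ∈ finiteSet L ∧ 0 < s := by
    have hc : Tendsto (fun s : ℝ => (-s) • k) (𝓝[>] 0) (𝓝 0) := by
      have : Continuous fun s : ℝ => (-s) • k := by fun_prop
      simpa using (this.tendsto 0).mono_left nhdsWithin_le_nhds
    exact ((hc.eventually (mem_interior_iff_mem_nhds.1 h0)).and self_mem_nhdsWithin).exists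
  set β := (L ((-s) • k)).toReal + 1
  set a := s / (1 + s) with ha
  set b := 1 / (1 + s) with hb
  have ha0 : 0 < a := by positivity
  have hb0 : 0 < b := by positivity
  have hab : a + b = 1 := by rw [ha, hb]; field_simp; ring
  have h := hL.combo_le hA (α := -(b * β + 1) / a) (hk ▸ EReal.bot_lt_coe _)
    (lt_coe_toReal_add hs one_pos) ha0.le hb0.le hab
  have hz : a • k + b • (-s) • k = 0 := by
    rw [smul_smul, ← add_smul, ha, hb]
    have : s / (1 + s) + 1 / (1 + s) * -s = 0 := by field_simp; ring
    rw [this, zero_smul]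
  rw [hz, hL.apply_zero] at h
  have h' : (0 : ℝ) ≤ a * (-(b * β + 1) / a) + b * β := by exact_mod_cast h
  rw [mul_div_cancel₀ _ ha0.ne'] at h'
  linarith

theorem IsScaledCumulantGenFun.convexOn [∀ T, IsProbabilityMeasure (P T)]
    (hL : IsScaledCumulantGenFun P A L) (hA : ∀ T, Measurable (A T))
    (h0 : (0 : EuclideanSpace ℝ (Fin n)) ∈ interior (finiteSet L)) :
    ConvexOn ℝ (finiteSet L) fun k => (L k).toReal := by
  have hc : Convex ℝ (finiteSet L) := fun x hx y hy a b ha hb hab =>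
    ⟨hL.ne_bot hA h0 _, ((hL.combo_le hA (lt_coe_toReal_add hx one_pos)
      (lt_coe_toReal_add hy one_pos) ha hb hab).trans_lt (EReal.coe_lt_top _)).ne⟩
  refine ⟨hc, fun x hx y hy a b ha hb hab => le_of_forall_pos_le_add fun ε hε => ?_⟩
  have h := hL.combo_le hA (lt_coe_toReal_add hx hε) (lt_coe_toReal_add hy hε) ha hb hab
  rw [← coe_toReal_of_mem_finiteSet (hc hx hy ha hb hab)] at h
  have h' := EReal.coe_le_coe_iff.1 h
  simp only [smul_eq_mul]
  linear_combination h' + ε * hab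

/-! ### Bounds for families of half-spaces -/

/-- If finitely many half-spaces `{v | α + L (k + h) ≤ ⟨h, v⟩}` cover `C`, then the probability
that `A T / T` lies in `C` under the exponentially tilted, unnormalised law `exp ⟨k, A T⟩ P T` has
exponential rate at most `-α`. -/
theorem IsScaledCumulantGenFun.expGrowthLE_of_cover (hL : IsScaledCumulantGenFun P A L)
    (hA : ∀ T, Measurable (A T)) (k : EuclideanSpace ℝ (Fin n))
    (F : Finset (EuclideanSpace ℝ (Fin n))) (α : ℝ) {C : Set (EuclideanSpace ℝ (Fin n))}
    (hF : ∀ h ∈ F, k + h ∈ finiteSet L)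
    (hC : ∀ v ∈ C, ∃ h ∈ F, α + (L (k + h)).toReal ≤ inner ℝ h v) :
    ExpGrowthLE (fun T => ∫⁻ x in {x | (T : ℝ)⁻¹ • A T x ∈ C},
      ENNReal.ofReal (Real.exp (inner ℝ k (A T x))) ∂(P T)) (-α) := by
  have hsum := ExpGrowthLE.sum F fun h hh => ((hL.expGrowthLE (hF h hh)).exp_mul
    (-(α + (L (k + h)).toReal))).mono (.of_forall fun _ => le_rfl)
    (show _ ≤ -α by linarith)
  refine hsum.mono ?_ le_rfl
  filter_upwards [eventually_gt_atTop 0] with T hT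
  have hT' : (0 : ℝ) < T := hT
  have hsub : {x | (T : ℝ)⁻¹ • A T x ∈ C} ⊆
      ⋃ h : F, {x | (α + (L (k + h)).toReal) * T ≤ inner ℝ (h : EuclideanSpace ℝ (Fin n))
        (A T x)} := fun x hx => by
    obtain ⟨h, hh, hle⟩ := hC _ hx
    refine Set.mem_iUnion.2 ⟨⟨h, hh⟩, ?_⟩
    rw [real_inner_smul_right, inv_mul_eq_div, le_div_iff₀ hT'] at hle
    exact hle
  refine (lintegral_mono_set hsub).trans ((lintegral_iUnion_le _ _).trans ?_)
  rw [tsum_fintype, ← Finset.sum_coe_sort F]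
  refine Finset.sum_le_sum fun h _ => ?_
  rw [neg_mul]
  exact setLIntegral_exp_halfspace_le (P T) (hA T) k h _

end Convexity

section Bounds

variable {n : ℕ} {L : EuclideanSpace ℝ (Fin n) → EReal}

/-! ### Upper bound for closed sets -/

/-- A closed set on which the Legendre transform of `L` exceeds `α` is covered by finitely many
half-spaces: the ones that witness the supremum on a compact part, and ones with small normals
outside a large ball. -/
theorem exists_finset_halfspace_cover
    (h0 : (0 : EuclideanSpace ℝ (Fin n)) ∈ interior (finiteSet L)) (hbot : ∀ k, L k ≠ ⊥)
    {C : Set (EuclideanSpace ℝ (Fin n))} (hC : IsClosed C) {α : ℝ}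
    (hα : ∀ a ∈ C, (α : EReal) < legendreTransform L a) :
    ∃ F : Finset (EuclideanSpace ℝ (Fin n)), (∀ h ∈ F, h ∈ finiteSet L) ∧
      ∀ v ∈ C, ∃ h ∈ F, α + (L h).toReal ≤ inner ℝ h v := by
  classical
  obtain ⟨H, hH⟩ := exists_finset_norm_le_inner n
  obtain ⟨s, hs, hs0⟩ : ∃ s : ℝ, (∀ h ∈ H, s • h ∈ finiteSet L) ∧ 0 < s := by
    have hc : ∀ h ∈ H, ∀ᶠ s : ℝ in 𝓝[>] 0, s • h ∈ finiteSet L := fun h _ => by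
      have hc : Continuous fun s : ℝ => s • h := by fun_prop
      have : Tendsto (fun s : ℝ => s • h) (𝓝[>] 0) (𝓝 0) := by
        simpa using (hc.tendsto 0).mono_left nhdsWithin_le_nhds
      exact this.eventually (mem_interior_iff_mem_nhds.1 h0)
    exact (((Finset.eventually_all H).2 hc).and self_mem_nhdsWithin).exists
  set ρ := (∑ h ∈ H, |α + (L (s • h)).toReal|) / s with hρ
  have hpt : ∀ a ∈ C, ∃ k ∈ finiteSet L, α + (L k).toReal < inner ℝ k a := fun a ha => by
    obtain ⟨k, hk⟩ := lt_iSup_iff.1 (hα a ha)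
    have hk' : k ∈ finiteSet L := by
      refine ⟨hbot k, fun htop => ?_⟩
      rw [htop, EReal.sub_top] at hk
      exact not_lt_bot hk
    refine ⟨k, hk', ?_⟩
    rw [← coe_toReal_of_mem_finiteSet hk', ← EReal.coe_sub, EReal.coe_lt_coe_iff] at hk
    linarith
  choose! κ hκ hκa using hpt
  have hK : IsCompact (C ∩ Metric.closedBall 0 ρ) := (isCompact_closedBall _ _).inter_left hC
  obtain ⟨t, htC, ht⟩ := hK.elim_nhds_subcover
    (fun a => {v | α + (L (κ a)).toReal < inner ℝ (κ a) v}) fun a ha =>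
      (isOpen_lt continuous_const (by fun_prop)).mem_nhds (hκa a ha.1)
  refine ⟨t.image κ ∪ H.image (s • ·), fun h hh => ?_, fun v hv => ?_⟩
  · rcases Finset.mem_union.1 hh with hh | hh
    · obtain ⟨a, ha, rfl⟩ := Finset.mem_image.1 hh
      exact hκ a (htC a ha).1
    · obtain ⟨g, hg, rfl⟩ := Finset.mem_image.1 hh
      exact hs g hg
  · by_cases hvρ : v ∈ Metric.closedBall 0 ρ
    · obtain ⟨a, ha, hav⟩ := Set.mem_iUnion₂.1 (ht ⟨hv, hvρ⟩)
      exact ⟨κ a, Finset.mem_union_left _ (Finset.mem_image_of_mem κ ha), le_of_lt hav⟩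
    · obtain ⟨h, hh, hle⟩ := hH v
      refine ⟨s • h, Finset.mem_union_right _ (Finset.mem_image_of_mem _ hh), ?_⟩
      rw [mem_closedBall_zero_iff, not_le] at hvρ
      calc α + (L (s • h)).toReal ≤ |α + (L (s • h)).toReal| := le_abs_self _
        _ ≤ ∑ h ∈ H, |α + (L (s • h)).toReal| :=
          Finset.single_le_sum (f := fun h => |α + (L (s • h)).toReal|)
            (fun _ _ => abs_nonneg _) hh
        _ = s * ρ := by rw [hρ]; field_simp
        _ ≤ s * inner ℝ h v := by gcongr; exact hvρ.le.trans hle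
        _ = inner ℝ (s • h) v := by rw [real_inner_smul_left]

variable {Ω : ℝ≥0 → Type*} [∀ T, MeasurableSpace (Ω T)]
  {P : ∀ T, Measure (Ω T)}
  {A : ∀ T, Ω T → EuclideanSpace ℝ (Fin n)}

theorem IsScaledCumulantGenFun.limsup_le [∀ T, IsProbabilityMeasure (P T)]
    (hL : IsScaledCumulantGenFun P A L) (hA : ∀ T, Measurable (A T))
    (h0 : (0 : EuclideanSpace ℝ (Fin n)) ∈ interior (finiteSet L))
    {B : Set (EuclideanSpace ℝ (Fin n))} (hB : MeasurableSet B) :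
    limsup (fun T : ℝ≥0 => ENNReal.log ((P T).map (fun x => (T : ℝ)⁻¹ • A T x) B) /
      ((T : ℝ) : EReal)) atTop ≤ -(⨅ a ∈ closure B, legendreTransform L a) := by
  rw [EReal.le_neg]
  refine EReal.ge_of_forall_gt_iff_ge.1 fun α hα => ?_
  rw [EReal.le_neg, ← EReal.coe_neg]
  obtain ⟨F, hF, hcov⟩ := exists_finset_halfspace_cover h0 (hL.ne_bot hA h0)
    (isClosed_closure (s := B)) fun a ha => hα.trans_le (iInf₂_le a ha)
  have h := hL.expGrowthLE_of_cover hA 0 F α (C := B) (by simpa using hF)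
    (fun v hv => by simpa using hcov v (subset_closure hv))
  refine ExpGrowthLE.limsup_le (h.mono (.of_forall fun T => ?_) le_rfl)
  rw [Measure.map_apply (by have := hA T; fun_prop) hB]
  simp [Set.preimage]

/-! ### Lower bound at gradients -/

/-- At a point `k` where `L` is differentiable with gradient `y`, the complement of a ball about `y`
is covered by finitely many half-spaces `{v | η - L k + L (k + h) ≤ ⟨h, v⟩}` with a gain `η > 0`. -/
theorem exists_finset_halfspace_cover_compl_ball {k y : EuclideanSpace ℝ (Fin n)}
    (hk : k ∈ interior (finiteSet L)) (hy : HasGradientAt (fun x => (L x).toReal) y k)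
    {δ : ℝ} (hδ : 0 < δ) :
    ∃ F : Finset (EuclideanSpace ℝ (Fin n)), ∃ η > 0, (∀ h ∈ F, k + h ∈ finiteSet L) ∧
      ∀ v ∈ (Metric.ball y δ)ᶜ, ∃ h ∈ F,
        η - (L k).toReal + (L (k + h)).toReal ≤ inner ℝ h v := by
  classical
  obtain ⟨H, hH⟩ := exists_finset_norm_le_inner n
  obtain ⟨s, hs, hs0⟩ : ∃ s : ℝ, (∀ h ∈ H, k + s • h ∈ finiteSet L ∧
      (L (k + s • h)).toReal - (L k).toReal - s * inner ℝ y h ≤ δ / 2 * s) ∧ 0 < s := by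
    have hc : ∀ h ∈ H, ∀ᶠ s : ℝ in 𝓝[>] 0, k + s • h ∈ finiteSet L ∧
        (L (k + s • h)).toReal - (L k).toReal - s * inner ℝ y h ≤ δ / 2 * s := fun h _ => by
      have hcont : Tendsto (fun s : ℝ => s • h) (𝓝 0) (𝓝 0) := by
        have hc : Continuous fun s : ℝ => s • h := by fun_prop
        simpa using hc.tendsto 0
      have hcont' : Tendsto (fun s : ℝ => k + s • h) (𝓝[>] 0) (𝓝 k) := by
        simpa using (hcont.const_add k).mono_left nhdsWithin_le_nhds
      have ho := ((hasGradientAt_iff_isLittleO_nhds_zero.1 hy).comp_tendsto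
        (hcont.mono_left (nhdsWithin_le_nhds (s := Set.Ioi 0)))).def
        (c := δ / 2 / (‖h‖ + 1)) (by positivity)
      filter_upwards [hcont'.eventually (mem_interior_iff_mem_nhds.1 hk), ho, self_mem_nhdsWithin]
        with s hs hs' (hs0 : 0 < s)
      refine ⟨hs, ?_⟩
      simp only [Function.comp_apply, real_inner_smul_right, norm_smul, Real.norm_eq_abs,
        abs_of_pos hs0] at hs'
      refine (le_abs_self _).trans (hs'.trans ?_)
      calc δ / 2 / (‖h‖ + 1) * (s * ‖h‖) = δ / 2 * s * (‖h‖ / (‖h‖ + 1)) := by ring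
        _ ≤ δ / 2 * s * 1 := by
          gcongr
          exact div_le_one_of_le₀ (by linarith) (by positivity)
        _ = δ / 2 * s := mul_one _
    exact (((Finset.eventually_all H).2 hc).and self_mem_nhdsWithin).exists
  refine ⟨H.image (s • ·), δ / 2 * s, by positivity, fun h hh => ?_, fun v hv => ?_⟩
  · obtain ⟨g, hg, rfl⟩ := Finset.mem_image.1 hh
    exact (hs g hg).1
  · obtain ⟨h, hh, hle⟩ := hH (v - y)
    refine ⟨s • h, Finset.mem_image_of_mem _ hh, ?_⟩
    have h1 := (hs h hh).2
    rw [Set.mem_compl_iff, mem_ball_iff_norm, not_lt] at hv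
    have h2 : s * δ ≤ s * inner ℝ h (v - y) := by gcongr; exact hv.trans hle
    rw [inner_sub_right, real_inner_comm y h] at h2
    rw [real_inner_smul_left]
    linarith

/-- Cramér's change of measure: if `L` is differentiable at `k` with gradient `y`, then under the
tilted laws `A T / T` concentrates near `y`, and undoing the tilt bounds the probability of any
neighbourhood of `y` from below. -/
theorem IsScaledCumulantGenFun.le_liminf_of_hasGradientAt (hL : IsScaledCumulantGenFun P A L)
    (hA : ∀ T, Measurable (A T)) {k y : EuclideanSpace ℝ (Fin n)}
    (hk : k ∈ interior (finiteSet L)) (hy : HasGradientAt (fun x => (L x).toReal) y k)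
    {B : Set (EuclideanSpace ℝ (Fin n))} (hB : MeasurableSet B) (hyB : y ∈ interior B) :
    (((L k).toReal - inner ℝ k y : ℝ) : EReal) ≤
      liminf (fun T : ℝ≥0 => ENNReal.log ((P T).map (fun x => (T : ℝ)⁻¹ • A T x) B) /
        ((T : ℝ) : EReal)) atTop := by
  refine le_liminf_log_div fun β hβ => ?_
  set f := (L k).toReal with hf
  set γ := f - inner ℝ k y - β with hγ
  have hγ0 : 0 < γ := by linarith
  obtain ⟨δ₀, hδ₀, hball⟩ := Metric.mem_nhds_iff.1 (mem_interior_iff_mem_nhds.1 hyB)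
  obtain ⟨δ, hδ, hδδ₀, hδk⟩ : ∃ δ : ℝ, 0 < δ ∧ δ ≤ δ₀ ∧ ‖k‖ * δ ≤ γ / 3 := by
    refine ⟨min δ₀ (γ / 3 / (‖k‖ + 1)), by positivity, min_le_left _ _, ?_⟩
    calc ‖k‖ * min δ₀ (γ / 3 / (‖k‖ + 1)) ≤ ‖k‖ * (γ / 3 / (‖k‖ + 1)) := by
          gcongr; exact min_le_right _ _
      _ = γ / 3 * (‖k‖ / (‖k‖ + 1)) := by ring
      _ ≤ γ / 3 * 1 := by
        gcongr
        exact div_le_one_of_le₀ (by linarith) (by positivity)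
      _ = γ / 3 := mul_one _
  obtain ⟨F, η, hη, hF, hcov⟩ := exists_finset_halfspace_cover_compl_ball hk hy hδ
  have hkS := interior_subset hk
  obtain ⟨ρ, hρ0, hργ, hρη⟩ : ∃ ρ : ℝ, 0 < ρ ∧ ρ ≤ γ / 3 ∧ ρ ≤ η / 3 :=
    ⟨min (γ / 3) (η / 3), by positivity, min_le_left _ _, min_le_right _ _⟩
  have htail := hL.expGrowthLE_of_cover hA k F (η - f) hF hcov (f - η + ρ) (by linarith)
  have htotal := hL.eventually_ge (k := k) (c := f - ρ) (by
    rw [← coe_toReal_of_mem_finiteSet hkS]; exact_mod_cast (by linarith))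
  filter_upwards [htail, htotal, eventually_le_exp_mul 2 (show 0 < η / 3 by positivity),
    eventually_le_exp_mul 2 (show 0 < γ / 3 by positivity), eventually_gt_atTop 0]
    with T htail htotal h2η h2γ hT
  have hT' : (0 : ℝ) < T := hT
  have hm : Measurable fun x => (T : ℝ)⁻¹ • A T x := by have := hA T; fun_prop
  set D := {x | (T : ℝ)⁻¹ • A T x ∈ (Metric.ball y δ)ᶜ} with hD
  have hDm : MeasurableSet D := hm Metric.isOpen_ball.measurableSet.compl
  set E := Real.exp ((f - ρ) * T) / 2 with hE
  have hE0 : 0 ≤ E := by positivity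
  -- The tilted mass of the complement of the ball is at most half of the total tilted mass.
  have hhalf : Real.exp ((f - η + ρ) * T) ≤ E := by
    rw [hE, le_div_iff₀ two_pos]
    calc Real.exp ((f - η + ρ) * T) * 2
        ≤ Real.exp ((f - η + ρ) * T) * Real.exp (η / 3 * T) := by gcongr
      _ = Real.exp ((f - η + ρ + η / 3) * T) := by rw [← Real.exp_add]; ring_nf
      _ ≤ Real.exp ((f - ρ) * T) := by gcongr; linarith
  have hin : ENNReal.ofReal E ≤
      ∫⁻ x in Dᶜ, ENNReal.ofReal (Real.exp (inner ℝ k (A T x))) ∂(P T) := by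
    rw [expMoment, ← lintegral_add_compl _ hDm] at htotal
    have h1 : ENNReal.ofReal E + ENNReal.ofReal E ≤ ENNReal.ofReal E +
        ∫⁻ x in Dᶜ, ENNReal.ofReal (Real.exp (inner ℝ k (A T x))) ∂(P T) := by
      rw [← ENNReal.ofReal_add hE0 hE0, show E + E = Real.exp ((f - ρ) * T) by rw [hE]; ring]
      refine htotal.trans ?_
      gcongr
      exact htail.trans (ENNReal.ofReal_le_ofReal hhalf)
    exact (ENNReal.add_le_add_iff_left ENNReal.ofReal_ne_top).1 h1
  have hup : ∫⁻ x in Dᶜ, ENNReal.ofReal (Real.exp (inner ℝ k (A T x))) ∂(P T) ≤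
      ENNReal.ofReal (Real.exp ((inner ℝ k y + γ / 3) * T)) * P T Dᶜ := by
    rw [← setLIntegral_const]
    refine setLIntegral_mono' hDm.compl fun x hx => ?_
    refine ENNReal.ofReal_le_ofReal (Real.exp_le_exp.2 ?_)
    have hx' : ‖(T : ℝ)⁻¹ • A T x - y‖ < δ := by
      rw [← mem_ball_iff_norm]; simpa [hD] using hx
    have h1 : inner ℝ k ((T : ℝ)⁻¹ • A T x - y) ≤ γ / 3 :=
      (real_inner_le_norm _ _).trans (le_trans (by gcongr) hδk)
    rw [inner_sub_right, real_inner_smul_right, inv_mul_eq_div, sub_le_iff_le_add,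
      div_le_iff₀ hT'] at h1
    linarith
  have hsub : P T Dᶜ ≤ (P T).map (fun x => (T : ℝ)⁻¹ • A T x) B := by
    rw [Measure.map_apply hm hB]
    refine measure_mono fun x hx => hball (Metric.ball_subset_ball hδδ₀ ?_)
    simpa [hD] using hx
  have hfin : ENNReal.ofReal (Real.exp ((inner ℝ k y + γ / 3) * T)) *
      ENNReal.ofReal (Real.exp (β * T)) ≤
      ENNReal.ofReal (Real.exp ((inner ℝ k y + γ / 3) * T)) * P T Dᶜ := by
    refine le_trans ?_ (hin.trans hup)
    rw [← ENNReal.ofReal_mul (Real.exp_pos _).le, ← Real.exp_add]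
    refine ENNReal.ofReal_le_ofReal ?_
    rw [hE, le_div_iff₀ two_pos]
    calc Real.exp ((inner ℝ k y + γ / 3) * T + β * T) * 2
        ≤ Real.exp ((inner ℝ k y + γ / 3) * T + β * T) * Real.exp (γ / 3 * T) := by gcongr
      _ = Real.exp ((f - γ / 3) * T) := by rw [← Real.exp_add, hγ]; ring_nf
      _ ≤ Real.exp ((f - ρ) * T) := by gcongr
  refine le_trans ?_ hsub
  exact (ENNReal.mul_le_mul_iff_right (by simp [Real.exp_pos]) ENNReal.ofReal_ne_top).1 hfin

end Bounds

/-! ### Steep convex functions -/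

section Steep

open scoped Pointwise

variable {E : Type*} [NormedAddCommGroup E] [InnerProductSpace ℝ E] [CompleteSpace E]

theorem inner_gradient_nonneg_of_isMinOn {g : E → ℝ} {C : Set E} (hC : Convex ℝ C) {k x v : E}
    (hk : k ∈ C) (hx : x ∈ C) (hmin : IsMinOn g C k) (hv : HasGradientAt g v k) :
    0 ≤ inner ℝ v (x - k) := by
  have h := hmin.localize.hasFDerivWithinAt_nonneg hv.hasFDerivAt.hasFDerivWithinAt
    (sub_mem_posTangentConeAt_of_segment_subset (hC.segment_subset hk hx))
  simpa using h

theorem inner_gradient_le_of_convexOn {g : E → ℝ} {U : Set E} (hg : ConvexOn ℝ U g) {k x v : E}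
    (hk : k ∈ U) (hx : x ∈ U) (hv : HasGradientAt g v k) :
    g k + inner ℝ v (x - k) ≤ g x := by
  have hφ : HasDerivAt (fun t : ℝ => g (AffineMap.lineMap k x t)) (inner ℝ v (x - k)) 0 := by
    have h1 : HasDerivAt (fun t : ℝ => AffineMap.lineMap k x t) (x - k) (0 : ℝ) :=
      AffineMap.hasDerivAt_lineMap
    have h2 : HasFDerivAt g (InnerProductSpace.toDual ℝ E v) (AffineMap.lineMap k x (0 : ℝ)) := by
      simpa using hv.hasFDerivAt
    exact (h2.comp_hasDerivAt (0 : ℝ) h1).congr_deriv (by simp)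
  have h : inner ℝ v (x - k) ≤ g x - g k := by
    refine le_of_tendsto hφ.tendsto_slope_zero_right ?_
    filter_upwards [Ioo_mem_nhdsGT (zero_lt_one' ℝ)] with t ht
    have := hg.2 hk hx (sub_nonneg.2 ht.2.le) ht.1.le (by ring)
    simp only [smul_eq_mul] at this
    simp only [zero_add, AffineMap.lineMap_apply_module, sub_zero, one_smul, zero_smul, add_zero,
      smul_eq_mul]
    rw [inv_mul_le_iff₀ ht.1]
    linarith
  linarith

variable [FiniteDimensional ℝ E]

/-- A convex function on an open convex set that is steep at the boundary and grows at least
quadratically attains its minimum. Minimisers over the slightly shrunk sets `c • closure U`, `c < 1`,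
exist by compactness; there the first-order condition and convexity bound the gradients, so that by
steepness the minimisers cannot approach the boundary of `U` as `c → 1`. -/
theorem exists_isMinOn_of_steep {g : E → ℝ} {U : Set E} (hU : IsOpen U) (h0 : (0 : E) ∈ U)
    (hg : ConvexOn ℝ U g) (hd : ∀ k ∈ U, DifferentiableAt ℝ g k)
    (hsteep : ∀ (u : ℕ → E) (x : E), (∀ m, u m ∈ U) → x ∈ frontier U → Tendsto u atTop (𝓝 x) →
      Tendsto (fun m => ‖gradient g (u m)‖) atTop atTop)
    {b η : ℝ} (hη : 0 < η) (hlow : ∀ k ∈ U, b + η * ‖k‖ ^ 2 ≤ g k) :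
    ∃ k ∈ U, IsMinOn g U k := by
  have hcont : ContinuousOn g U := fun k hk => (hd k hk).continuousAt.continuousWithinAt
  obtain ⟨r, hr0, hr⟩ : ∃ r > 0, Metric.closedBall (0 : E) r ⊆ U :=
    Metric.nhds_basis_closedBall.mem_iff.1 (hU.mem_nhds h0)
  set ρ := √((g 0 - b) / η) with hρ
  have hbdd : ∀ k ∈ U, g k ≤ g 0 → ‖k‖ ≤ ρ := fun k hk hle => by
    refine Real.le_sqrt_of_sq_le ?_
    rw [le_div_iff₀ hη]
    linarith [hlow k hk]
  set c : ℕ → ℝ := fun m => 1 - 1 / ((m : ℝ) + 2) with hc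
  have hc1 : ∀ m, c m < 1 := fun m => by
    have : 0 < 1 / ((m : ℝ) + 2) := by positivity
    simp only [hc]; linarith
  have hc2 : ∀ m, 1 / 2 ≤ c m := fun m => by
    have : 1 / ((m : ℝ) + 2) ≤ 1 / 2 := by gcongr; linarith [(m.cast_nonneg : (0 : ℝ) ≤ m)]
    simp only [hc]; linarith
  have hc0 : ∀ m, 0 < c m := fun m => by linarith [hc2 m]
  have hclim : Tendsto c atTop (𝓝 1) := by
    have : Tendsto (fun m : ℕ => 1 / ((m : ℝ) + 2)) atTop (𝓝 0) :=
      tendsto_const_nhds.div_atTop (tendsto_atTop_add_const_right _ _ tendsto_natCast_atTop_atTop)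
    simpa only [sub_zero] using tendsto_const_nhds.sub this
  set C : ℕ → Set E := fun m => c m • closure U with hC
  have hCmem : ∀ m x, x ∈ C m ↔ (c m)⁻¹ • x ∈ closure U := fun m x =>
    Set.mem_smul_set_iff_inv_smul_mem₀ (hc0 m).ne' _ _
  have hCU : ∀ m, C m ⊆ U := fun m x hx => by
    obtain ⟨z, hz, rfl⟩ := hx
    have := hg.1.combo_interior_closure_mem_interior (hU.interior_eq.symm ▸ h0) hz
      (sub_pos.2 (hc1 m)) (hc0 m).le (by ring)
    rwa [smul_zero, zero_add, hU.interior_eq] at this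
  have h0C : ∀ m, (0 : E) ∈ C m := fun m => by
    rw [hCmem, smul_zero]; exact subset_closure h0
  have hmin : ∀ m, ∃ k ∈ C m, IsMinOn g (C m) k := fun m => by
    refine (hcont.mono (hCU m)).exists_isMinOn' (isClosed_closure.smul₀ _) (h0C m) ?_
    rw [eventually_inf_principal]
    filter_upwards [(isCompact_closedBall (0 : E) ρ).compl_mem_cocompact] with k hk hkC
    by_contra! hlt
    exact hk (mem_closedBall_zero_iff.2 (hbdd k (hCU m hkC) hlt.le))
  choose k hkC hkmin using hmin
  have hkU : ∀ m, k m ∈ U := fun m => hCU m (hkC m)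
  have hkρ : ∀ m, k m ∈ Metric.closedBall (0 : E) ρ := fun m =>
    mem_closedBall_zero_iff.2 (hbdd _ (hkU m) (hkmin m (h0C m)))
  obtain ⟨x, -, φ, hφ, hx⟩ := (isCompact_closedBall (0 : E) ρ).tendsto_subseq hkρ
  have hgrad : ∀ m, ‖gradient g (k m)‖ ≤ 2 * (g 0 - b) / r := fun m => by
    set v := gradient g (k m) with hv
    have hvg : HasGradientAt g v (k m) := (hd _ (hkU m)).hasGradientAt
    rcases eq_or_ne v 0 with h | h
    · rw [h, norm_zero]
      have := hlow 0 h0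
      simp only [norm_zero] at this
      refine div_nonneg ?_ hr0.le
      linarith
    -- The point `-(r / 2) • v / ‖v‖` lies in `C m` because `c m ≥ 1 / 2`.
    have hz : (-(r / 2 / ‖v‖)) • v ∈ C m := by
      rw [hCmem]
      refine subset_closure (hr (mem_closedBall_zero_iff.2 ?_))
      rw [norm_smul, norm_smul, norm_neg, norm_div, norm_norm,
        div_mul_cancel₀ _ (norm_ne_zero_iff.2 h), norm_inv, Real.norm_of_nonneg (hc0 m).le,
        Real.norm_of_nonneg (by positivity), inv_mul_le_iff₀ (hc0 m)]
      nlinarith [hc2 m]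
    have h1 := inner_gradient_nonneg_of_isMinOn (hg.1.closure.smul _) (hkC m) hz (hkmin m) hvg
    have h2 := inner_gradient_le_of_convexOn hg (hkU m) h0 hvg
    rw [inner_sub_right, real_inner_smul_right, real_inner_self_eq_norm_sq] at h1
    rw [zero_sub, inner_neg_right] at h2
    have h3 : -(r / 2 / ‖v‖) * ‖v‖ ^ 2 = -(r / 2 * ‖v‖) := by
      have := norm_ne_zero_iff.2 h
      field_simp
    rw [h3] at h1
    have h4 : b ≤ g (k m) := le_trans (by simp only [le_add_iff_nonneg_right]; positivity)
      (hlow _ (hkU m))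
    rw [le_div_iff₀ hr0]
    linarith
  have hxU : x ∈ U := by
    by_contra hxU
    have hfr : x ∈ frontier U := by
      rw [hU.frontier_eq]
      exact ⟨mem_closure_of_tendsto hx (.of_forall fun m => hkU _), hxU⟩
    obtain ⟨m, hm⟩ := ((hsteep _ x (fun m => hkU (φ m)) hfr hx).eventually_gt_atTop
      (2 * (g 0 - b) / r)).exists
    exact (hgrad (φ m)).not_gt hm
  refine ⟨x, hxU, fun z hz => ?_⟩
  refine le_of_tendsto ((hd x hxU).continuousAt.tendsto.comp hx) ?_
  have hcz : Tendsto (fun m => (c (φ m))⁻¹ • z) atTop (𝓝 z) := by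
    simpa using ((hclim.comp hφ.tendsto_atTop).inv₀ one_ne_zero).smul_const z
  filter_upwards [hcz.eventually (hU.mem_nhds hz)] with m hm
  exact hkmin (φ m) ((hCmem _ _).2 (subset_closure hm))

end Steep

/-! ### Gradients are dense in the effective domain of the rate function -/

section Density

variable {n : ℕ} {L : EuclideanSpace ℝ (Fin n) → EReal}

/-- For an essentially smooth convex function `f` and any slope `a` at which its conjugate is at most
`c`, there are gradients of `f` arbitrarily close to `a` at which the conjugate is still at most `c`.
They are the gradients at the minimisers of `f - ⟨·, a⟩ + ε ‖·‖² / 2`. -/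
theorem IsEssentiallySmooth.exists_hasGradientAt_near (hS : IsEssentiallySmooth L)
    (hconv : ConvexOn ℝ (finiteSet L) fun k => (L k).toReal) (hL0 : L 0 = 0)
    {a : EuclideanSpace ℝ (Fin n)} {c : ℝ}
    (hc : ∀ k ∈ finiteSet L, inner ℝ k a - (L k).toReal ≤ c) {δ : ℝ} (hδ : 0 < δ) :
    ∃ k ∈ interior (finiteSet L), ∃ y, HasGradientAt (fun x => (L x).toReal) y k ∧ dist y a < δ ∧
      inner ℝ k y - (L k).toReal ≤ c := by
  set f : EuclideanSpace ℝ (Fin n) → ℝ := fun k => (L k).toReal with hf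
  have hf0 : f 0 = 0 := by simp [hf, hL0]
  have hc0 : 0 ≤ c := by simpa [hL0] using hc 0 (interior_subset hS.zero_mem)
  obtain ⟨ε, hε, hεδ⟩ : ∃ ε : ℝ, 0 < ε ∧ ε * (2 * c + 1) = δ ^ 2 :=
    ⟨δ ^ 2 / (2 * c + 1), by positivity, by field_simp⟩
  set g : EuclideanSpace ℝ (Fin n) → ℝ := fun k => f k - inner ℝ a k + ε / 2 * ‖k‖ ^ 2 with hg
  have hgrad : ∀ k v, HasGradientAt f v k → HasGradientAt g (v - a + ε • k) k := fun k v hv => by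
    rw [hasGradientAt_iff_hasFDerivAt] at hv ⊢
    have h1 : HasFDerivAt (fun k => inner ℝ a k) (InnerProductSpace.toDual ℝ _ a) k :=
      (InnerProductSpace.toDual ℝ (EuclideanSpace ℝ (Fin n)) a).hasFDerivAt
    have h2 := (hasStrictFDerivAt_norm_sq k).hasFDerivAt.const_mul (ε / 2)
    refine ((hv.sub h1).add h2).congr_fderiv ?_
    ext z
    simp
    ring
  have hgconv : ConvexOn ℝ (interior (finiteSet L)) g := by
    have hi := hconv.1.interior
    refine ((hconv.subset interior_subset hi).sub ?_).add ?_
    · exact (innerₛₗ ℝ a).concaveOn hi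
    · exact ((convexOn_norm hi).pow (fun _ _ => norm_nonneg _) 2).smul (by positivity)
  have hlow : ∀ k ∈ interior (finiteSet L), -c + ε / 2 * ‖k‖ ^ 2 ≤ g k := fun k hk => by
    have := hc k (interior_subset hk)
    simp only [hg, real_inner_comm k a]
    linarith
  have hsteep : ∀ (u : ℕ → EuclideanSpace ℝ (Fin n)) (x : EuclideanSpace ℝ (Fin n)),
      (∀ m, u m ∈ interior (finiteSet L)) → x ∈ frontier (interior (finiteSet L)) →
      Tendsto u atTop (𝓝 x) → Tendsto (fun m => ‖gradient g (u m)‖) atTop atTop :=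
    fun u x hu hx hux => by
      have hb : Tendsto (fun m => -‖a - ε • u m‖) atTop (𝓝 (-‖a - ε • x‖)) :=
        ((hux.const_smul ε).const_sub a).norm.neg
      refine tendsto_atTop_mono (fun m => ?_) ((hS.steep u x hu hx hux).atTop_add hb)
      rw [(hgrad _ _ (hS.differentiableAt _ (hu m)).hasGradientAt).gradient, ← sub_eq_add_neg]
      refine (norm_sub_norm_le _ _).trans_eq ?_
      congr 1
      abel
  obtain ⟨k, hk, hmin⟩ := exists_isMinOn_of_steep isOpen_interior hS.zero_mem hgconv
    (fun k hk => (hgrad k _ (hS.differentiableAt k hk).hasGradientAt).differentiableAt) hsteep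
    (half_pos hε) hlow
  have hfk := (hS.differentiableAt k hk).hasGradientAt
  have hzero : gradient f k - a + ε • k = 0 := by
    have h1 := (hmin.isLocalMin (isOpen_interior.mem_nhds hk)).hasFDerivAt_eq_zero
      (hgrad k _ hfk).hasFDerivAt
    exact (map_eq_zero_iff _ (InnerProductSpace.toDual ℝ _).injective).1 h1
  have hy : gradient f k = a - ε • k := by
    rw [← sub_eq_zero, ← hzero]; abel
  have hk0 : g k ≤ g 0 := hmin hS.zero_mem
  have hcl := hc k (interior_subset hk)
  simp only [hg, hf0, inner_zero_right, norm_zero, real_inner_comm k a] at hk0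
  refine ⟨k, hk, a - ε • k, hy ▸ hfk, ?_, ?_⟩
  · rw [dist_eq_norm, sub_sub_cancel_left, norm_neg, norm_smul, Real.norm_of_nonneg hε.le]
    refine lt_of_pow_lt_pow_left₀ 2 hδ.le ?_
    rw [← hεδ]
    have : ε / 2 * ‖k‖ ^ 2 ≤ c := by linarith
    nlinarith
  · rw [inner_sub_right, real_inner_smul_right, real_inner_self_eq_norm_sq]
    have : 0 ≤ ε * ‖k‖ ^ 2 := by positivity
    linarith

end Density

section Main

variable {n : ℕ} {L : EuclideanSpace ℝ (Fin n) → EReal}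

/-! ### The large deviation principle -/

theorem legendreTransform_nonneg (h0 : L 0 = 0) (a : EuclideanSpace ℝ (Fin n)) :
    0 ≤ legendreTransform L a :=
  le_iSup_of_le 0 (by simp [h0])

theorem lowerSemicontinuous_legendreTransform (L : EuclideanSpace ℝ (Fin n) → EReal) :
    LowerSemicontinuous (legendreTransform L) := by
  refine lowerSemicontinuous_iSup fun k => Continuous.lowerSemicontinuous ?_
  induction hk : L k with
  | bot => simpa using continuous_const
  | top => simpa using continuous_const
  | coe r =>
    simp_rw [← EReal.coe_sub]
    exact continuous_coe_real_ereal.comp (by fun_prop)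

theorem IsFiniteDifferentiable.isEssentiallySmooth (h : IsFiniteDifferentiable L) :
    IsEssentiallySmooth L := by
  have hS : finiteSet L = Set.univ := Set.eq_univ_of_forall h.finite
  refine ⟨by simp [hS], fun k _ => h.differentiable k, fun u x _ hx _ => ?_⟩
  simp [hS] at hx

variable {Ω : ℝ≥0 → Type*} [∀ T, MeasurableSpace (Ω T)]
  {P : ∀ T, Measure (Ω T)} {A : ∀ T, Ω T → EuclideanSpace ℝ (Fin n)}

theorem IsScaledCumulantGenFun.le_liminf [∀ T, IsProbabilityMeasure (P T)]
    (hL : IsScaledCumulantGenFun P A L) (hA : ∀ T, Measurable (A T)) (hS : IsEssentiallySmooth L)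
    {B : Set (EuclideanSpace ℝ (Fin n))} (hB : MeasurableSet B) :
    -(⨅ a ∈ interior B, legendreTransform L a) ≤
      liminf (fun T : ℝ≥0 => ENNReal.log ((P T).map (fun x => (T : ℝ)⁻¹ • A T x) B) /
        ((T : ℝ) : EReal)) atTop := by
  rw [EReal.neg_le]
  refine le_iInf₂ fun a ha => EReal.le_of_forall_lt_iff_le.1 fun c hc => ?_
  have hconj : ∀ k ∈ finiteSet L, inner ℝ k a - (L k).toReal ≤ c := fun k hk => by
    have h := (le_iSup (fun k => ((inner ℝ k a : ℝ) : EReal) - L k) k).trans hc.le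
    rw [← coe_toReal_of_mem_finiteSet hk] at h
    exact_mod_cast h
  obtain ⟨δ, hδ, hball⟩ := Metric.isOpen_iff.1 isOpen_interior a ha
  obtain ⟨k, hk, y, hy, hya, hky⟩ := hS.exists_hasGradientAt_near (hL.convexOn hA hS.zero_mem)
    hL.apply_zero hconj hδ
  have h := hL.le_liminf_of_hasGradientAt hA hk hy hB (hball hya)
  rw [EReal.neg_le]
  refine le_trans ?_ h
  rw [← EReal.coe_neg, EReal.coe_le_coe_iff]
  linarith

/-- The Gärtner–Ellis theorem. Lower semicontinuity of `L` is not needed: `L` only matters on the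
interior of its effective domain. -/
theorem IsScaledCumulantGenFun.isLargeDeviationPrinciple [∀ T, IsProbabilityMeasure (P T)]
    (hL : IsScaledCumulantGenFun P A L) (hA : ∀ T, Measurable (A T))
    (hS : IsEssentiallySmooth L) :
    IsLargeDeviationPrinciple (fun T => (P T).map (fun x => (T : ℝ)⁻¹ • A T x))
      (legendreTransform L) where
  nonneg := legendreTransform_nonneg hL.apply_zero
  lowerSemicontinuous := lowerSemicontinuous_legendreTransform L
  lower_bound _ hB := hL.le_liminf hA hS hB
  upper_bound _ hB := hL.limsup_le hA hS.zero_mem hB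

/-! ### The fluctuation symmetry -/

/-- The change of measure by `R`: the exponential moment of `A` at `k'` is an exponential moment at
`k - w`, up to the boundary term `B`. -/
theorem expMoment_eq_of_covariant {Ω : Type*} [MeasurableSpace Ω] {P : Measure Ω}
    [IsProbabilityMeasure P] {R : Ω ≃ᵐ Ω} (hPR : P.map R.symm ≪ P) (hRP : P ≪ P.map R.symm)
    {A : Ω → EuclideanSpace ℝ (Fin n)} (hA : Measurable A) {w k k' : EuclideanSpace ℝ (Fin n)}
    {M : EuclideanSpace ℝ (Fin n) → EuclideanSpace ℝ (Fin n)}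
    (hcov : ∀ᵐ x ∂P, A (R x) = M (A x)) (hk : ∀ a, inner ℝ k' (M a) = inner ℝ k a) {B : Ω → ℝ}
    (hdec : ∀ᵐ x ∂P, entropicFunctional P P R x = inner ℝ w (A x) + B x) :
    expMoment P A k' = ∫⁻ x, ENNReal.ofReal (Real.exp (inner ℝ (k - w) (A x) - B x)) ∂P := by
  have : IsProbabilityMeasure (P.map R.symm) :=
    Measure.isProbabilityMeasure_map R.symm.measurable.aemeasurable
  have hmeas : Measurable fun x => ENNReal.ofReal (Real.exp (inner ℝ k' (A (R x)))) := by
    have := hA.comp R.measurable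
    exact measurable_expInner this k'
  calc expMoment P A k'
      = ∫⁻ x, ENNReal.ofReal (Real.exp (inner ℝ k' (A (R x)))) ∂(P.map R.symm) := by
        rw [lintegral_map_equiv, expMoment]
        simp
    _ = ∫⁻ x, (P.map R.symm).rnDeriv P x *
          ENNReal.ofReal (Real.exp (inner ℝ k' (A (R x)))) ∂P :=
        (lintegral_rnDeriv_mul hPR hmeas.aemeasurable).symm
    _ = ∫⁻ x, ENNReal.ofReal (Real.exp (inner ℝ (k - w) (A x) - B x)) ∂P := by
        refine lintegral_congr_ae ?_
        filter_upwards [hcov, hdec, exp_llr_of_ac' (P.map R.symm) P hRP,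
          Measure.rnDeriv_lt_top (P.map R.symm) P] with x h1 h2 h3 h4
        have h5 : entropicFunctional P P R x = -llr (P.map R.symm) P x := rfl
        rw [h5] at h2
        rw [h1, hk, ← ENNReal.ofReal_toReal h4.ne, ← h3,
          ← ENNReal.ofReal_mul (Real.exp_pos _).le, ← Real.exp_add, inner_sub_left]
        congr 2
        linarith

/-- Dropping a bounded term `B` from the exponent costs at most a factor `exp c` either way. -/
theorem expMoment_compare {Ω : Type*} [MeasurableSpace Ω] {P : Measure Ω}
    {A : Ω → EuclideanSpace ℝ (Fin n)} (hA : Measurable A) {k k' : EuclideanSpace ℝ (Fin n)}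
    {B : Ω → ℝ} {c : ℝ} (hB : ∀ᵐ x ∂P, |B x| ≤ c)
    (h : expMoment P A k' = ∫⁻ x, ENNReal.ofReal (Real.exp (inner ℝ k (A x) - B x)) ∂P) :
    expMoment P A k' ≤ ENNReal.ofReal (Real.exp c) * expMoment P A k ∧
      expMoment P A k ≤ ENNReal.ofReal (Real.exp c) * expMoment P A k' := by
  constructor
  · rw [h, expMoment, ← lintegral_const_mul _ (measurable_expInner hA k)]
    refine lintegral_mono_ae ?_
    filter_upwards [hB] with x hx
    rw [← ENNReal.ofReal_mul (Real.exp_pos _).le, ← Real.exp_add]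
    refine ENNReal.ofReal_le_ofReal (Real.exp_le_exp.2 ?_)
    linarith [(abs_le.1 hx).1]
  · rw [h, expMoment, ← lintegral_const_mul' _ _ ENNReal.ofReal_ne_top]
    refine lintegral_mono_ae ?_
    filter_upwards [hB] with x hx
    rw [← ENNReal.ofReal_mul (Real.exp_pos _).le, ← Real.exp_add]
    refine ENNReal.ofReal_le_ofReal (Real.exp_le_exp.2 ?_)
    linarith [(abs_le.1 hx).2]

theorem eventually_ae_abs_le {B : ∀ T, Ω T → ℝ}
    (hB : Tendsto (fun T : ℝ≥0 => essSup (fun x => ‖B T x‖ₑ) (P T) / (T : ℝ≥0∞)) atTop (𝓝 0))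
    {δ : ℝ} (hδ : 0 < δ) : ∀ᶠ T : ℝ≥0 in atTop, ∀ᵐ x ∂(P T), |B T x| ≤ δ * T := by
  filter_upwards [hB.eventually_lt_const (ENNReal.ofReal_pos.2 hδ), eventually_gt_atTop 0]
    with T hT hpos
  filter_upwards [ENNReal.ae_le_essSup fun x => ‖B T x‖ₑ] with x hx
  rw [ENNReal.div_lt_iff (.inl (by exact_mod_cast hpos.ne')) (.inl ENNReal.coe_ne_top),
    ← ENNReal.ofReal_coe_nnreal, ← ENNReal.ofReal_mul hδ.le] at hT
  have h := hx.trans hT.le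
  rwa [Real.enorm_eq_ofReal_abs, ENNReal.ofReal_le_ofReal_iff (by positivity)] at h

theorem IsScaledCumulantGenFun.le_of_expMoment_le (hL : IsScaledCumulantGenFun P A L)
    {x y : EuclideanSpace ℝ (Fin n)}
    (h : ∀ δ > 0, ∀ᶠ T : ℝ≥0 in atTop, expMoment (P T) (A T) x ≤
      ENNReal.ofReal (Real.exp (δ * T)) * expMoment (P T) (A T) y) : L x ≤ L y := by
  refine EReal.le_of_forall_lt_iff_le.1 fun c hc => ?_
  obtain ⟨b, hyb, hbc⟩ := EReal.lt_iff_exists_real_btwn.1 hc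
  have hbc' : b < c := by exact_mod_cast hbc
  refine hL.le_of_eventually_le ?_
  filter_upwards [h (c - b) (sub_pos.2 hbc'), hL.eventually_le hyb] with T h1 h2
  calc expMoment (P T) (A T) x
      ≤ ENNReal.ofReal (Real.exp ((c - b) * T)) * ENNReal.ofReal (Real.exp (b * T)) := by
        refine h1.trans ?_
        gcongr
    _ = ENNReal.ofReal (Real.exp (c * T)) := by
      rw [← ENNReal.ofReal_mul (Real.exp_pos _).le, ← Real.exp_add]; ring_nf

/-- A symmetry `L ∘ N = L (· - w)` of `L` becomes, for a surjective `N` whose inverse adjoint is `M`,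
the symmetry `I ∘ M = ⟨w, ·⟩ + I` of the Legendre transform `I`. -/
theorem legendreTransform_covariant {M N : EuclideanSpace ℝ (Fin n) → EuclideanSpace ℝ (Fin n)}
    (hN : Function.Surjective N) (hMN : ∀ k a, inner ℝ (N k) (M a) = inner ℝ k a)
    {w : EuclideanSpace ℝ (Fin n)} (hL : ∀ k, L (N k) = L (k - w)) (a : EuclideanSpace ℝ (Fin n)) :
    legendreTransform L (M a) = ((inner ℝ w a : ℝ) : EReal) + legendreTransform L a := by
  have h1 : legendreTransform L (M a) =
      ⨆ k, ((inner ℝ w a : ℝ) : EReal) + (((inner ℝ k a : ℝ) : EReal) - L k) := by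
    rw [legendreTransform, ← hN.iSup_comp, ← (Equiv.addRight w).surjective.iSup_comp]
    refine iSup_congr fun k => ?_
    rw [hMN, hL, Equiv.coe_addRight, add_sub_cancel_right, inner_add_left, EReal.coe_add,
      sub_eq_add_neg, sub_eq_add_neg, add_comm ((inner ℝ k a : ℝ) : EReal), add_assoc]
  rw [h1, legendreTransform]
  refine le_antisymm (iSup_le fun k => ?_) ?_
  · gcongr
    exact le_iSup (fun k => ((inner ℝ k a : ℝ) : EReal) - L k) k
  · rw [add_comm, ← EReal.le_sub_iff_add_le (.inl (EReal.coe_ne_bot _)) (.inl (EReal.coe_ne_top _))]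
    refine iSup_le fun k => ?_
    rw [EReal.le_sub_iff_add_le (.inl (EReal.coe_ne_bot _)) (.inl (EReal.coe_ne_top _)), add_comm]
    exact le_iSup (fun k => ((inner ℝ w a : ℝ) : EReal) + (((inner ℝ k a : ℝ) : EReal) - L k)) k

theorem toEuclideanLin_apply_apply_of_mul_eq_one {M N : Matrix (Fin n) (Fin n) ℝ} (h : M * N = 1)
    (k : EuclideanSpace ℝ (Fin n)) :
    Matrix.toEuclideanLin M (Matrix.toEuclideanLin N k) = k := by
  simp [Matrix.toLpLin_apply, Matrix.mulVec_mulVec, h]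

theorem inner_toEuclideanLin_transpose_inv {M : Matrix (Fin n) (Fin n) ℝ} (hM : IsUnit M)
    (k a : EuclideanSpace ℝ (Fin n)) :
    inner ℝ (Matrix.toEuclideanLin (M.transpose)⁻¹ k) (Matrix.toEuclideanLin M a) =
      inner ℝ k a := by
  have hdet : IsUnit M.transpose.det := by
    rwa [Matrix.det_transpose, ← Matrix.isUnit_iff_isUnit_det]
  rw [← LinearMap.adjoint_inner_left, ← Matrix.toEuclideanLin_conjTranspose_eq_adjoint,
    Matrix.conjTranspose_eq_transpose_of_trivial,
    toEuclideanLin_apply_apply_of_mul_eq_one (Matrix.mul_nonsing_inv _ hdet)]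

theorem surjective_toEuclideanLin_transpose_inv {M : Matrix (Fin n) (Fin n) ℝ} (hM : IsUnit M) :
    Function.Surjective (Matrix.toEuclideanLin (M.transpose)⁻¹) := fun k => by
  have hdet : IsUnit M.transpose.det := by
    rwa [Matrix.det_transpose, ← Matrix.isUnit_iff_isUnit_det]
  exact ⟨_, toEuclideanLin_apply_apply_of_mul_eq_one (Matrix.nonsing_inv_mul _ hdet) k⟩

end Main

end FluctuationRelation

theorem theorem2 {n : ℕ} {Ω : ℝ≥0 → Type*} [∀ T, MeasurableSpace (Ω T)]
    (P : ∀ T, Measure (Ω T)) [∀ T, IsProbabilityMeasure (P T)]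
    (R : ∀ T, Ω T ≃ᵐ Ω T)
    (hPR : ∀ T, (P T).map (R T).symm ≪ P T) (hRP : ∀ T, P T ≪ (P T).map (R T).symm)
    (A : ∀ T, Ω T → EuclideanSpace ℝ (Fin n)) (hA : ∀ T, Measurable (A T))
    (w : EuclideanSpace ℝ (Fin n))
    (M : Matrix (Fin n) (Fin n) ℝ) (hM : IsUnit M)
    (hcov : ∀ T, ∀ᵐ x ∂(P T), A T (R T x) = Matrix.toEuclideanLin M (A T x))
    (B : ∀ T, Ω T → ℝ)
    (hdec : ∀ T, ∀ᵐ x ∂(P T),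
      FluctuationRelation.entropicFunctional (P T) (P T) (R T) x = inner ℝ w (A T x) + B T x)
    (hB : Tendsto (fun T : ℝ≥0 => essSup (fun x => ‖B T x‖ₑ) (P T) / (T : ℝ≥0∞)) atTop (𝓝 0))
    (L : EuclideanSpace ℝ (Fin n) → EReal)
    (hL : FluctuationRelation.IsScaledCumulantGenFun P A L)
    (hL' : FluctuationRelation.IsFiniteDifferentiable L ∨
      FluctuationRelation.IsEssentiallySmooth L) :
    (∀ k : EuclideanSpace ℝ (Fin n), L (Matrix.toEuclideanLin (M.transpose)⁻¹ k) = L (k - w)) ∧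
    ∃ I : EuclideanSpace ℝ (Fin n) → EReal,
      FluctuationRelation.IsLargeDeviationPrinciple
        (fun T => (P T).map (fun x => (T : ℝ)⁻¹ • A T x)) I ∧
      (∀ a, I a = FluctuationRelation.legendreTransform L a) ∧
      ∀ a, I (Matrix.toEuclideanLin M a) = ((inner ℝ w a : ℝ) : EReal) + I a := by
  have hS : FluctuationRelation.IsEssentiallySmooth L :=
    hL'.elim FluctuationRelation.IsFiniteDifferentiable.isEssentiallySmooth id
  have hinner := FluctuationRelation.inner_toEuclideanLin_transpose_inv hM
  have hsymm : ∀ k : EuclideanSpace ℝ (Fin n),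
      L (Matrix.toEuclideanLin (M.transpose)⁻¹ k) = L (k - w) := fun k => by
    have hcmp : ∀ δ : ℝ, 0 < δ → ∀ᶠ T : ℝ≥0 in atTop, _ ∧ _ := fun δ hδ =>
      (FluctuationRelation.eventually_ae_abs_le hB hδ).mono fun T hT =>
        FluctuationRelation.expMoment_compare (hA T) hT
          (FluctuationRelation.expMoment_eq_of_covariant (hPR T) (hRP T) (hA T) (hcov T)
            (hinner k) (hdec T))
    exact le_antisymm (hL.le_of_expMoment_le fun δ hδ => (hcmp δ hδ).mono fun _ h => h.1)
      (hL.le_of_expMoment_le fun δ hδ => (hcmp δ hδ).mono fun _ h => h.2)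
  exact ⟨hsymm, FluctuationRelation.legendreTransform L, hL.isLargeDeviationPrinciple hA hS,
    fun _ => rfl, FluctuationRelation.legendreTransform_covariant
      (FluctuationRelation.surjective_toEuclideanLin_transpose_inv hM) hinner hsymm⟩
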